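/- Let $X$ be a complex Banach space with dual $X^{*}$, and let $T$ be a bounded linear operator on $X$ with dual operator $T^{*}\colon X^{*}\to X^{*}$, $T^{*}f=f\circ T$. Write $\mathcal N$ and $\mathcal R$ for kernel and range. For a bounded operator $S$ on a normed space let $$\operatorname{dis}(S)=\inf\{m\in\mathbb N:\ \mathcal N(S)\cap\mathcal R(S^{m})=\mathcal N(S)\cap\mathcal R(S^{r})\ \text{for all } r\ge m\}\qquad(\inf\emptyset=\infty,\ 0\in\mathbb N).$$ Call $S$ semi-regular if $\mathcal R(S)$ is closed and $\operatorname{dis}(S)=0$, and call $S$ nilpotent of degree $d$ if $d$ is the least natural number with $S^{d}=0$ (so the operator on the zero space is nilpotent of degree $0$). A bounded operator $S$ on a Banach space $Y$ is of Kato-type of degree $d$ if there are closed $S$-invariant subspaces $M,N$ of $Y$ with $Y=M\oplus N$ such that the restriction of $S$ to $M$ is semi-regular and the restriction of $S$ to $N$ is nilpotent of degree $d$. If $T$ is of Kato-type of degree $d$, then $T^{*}$ is of Kato-type with the same degree $d$. Moreover, $\mathcal R(T^{*})+\mathcal N((T^{*})^{d})$ is closed in $X^{*}$ for the weak-$*$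 topology $\sigma(X^{*},X)$. -/

import Mathlib

namespace KatoType

variable {E : Type*} [NormedAddCommGroup E] [NormedSpace ℂ E]

/-- The kernel `N(T_[n]) = N(T) ∩ R(T ^ n)` of the restriction `T_[n]` of `T` to `R(T ^ n)`,
as a subspace of `E`. -/
def kerRestrict (T : E →L[ℂ] E) (n : ℕ) : Submodule ℂ E :=
  LinearMap.ker (T : E →ₗ[ℂ] E) ⊓ LinearMap.range ((T ^ n : E →L[ℂ] E) : E →ₗ[ℂ] E)

/-- The set `Δ(T)` of all `m` such that `N(T_[m]) = N(T_[r])` for every `r ≥ m`. -/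
def stableSet (T : E →L[ℂ] E) : Set ℕ :=
  {m | ∀ r : ℕ, m ≤ r → kerRestrict T m = kerRestrict T r}

/-- The degree of stable iteration `dis(T) = inf Δ(T)`, with `inf ∅ = ∞`. -/
noncomputable def dis (T : E →L[ℂ] E) : ℕ∞ :=
  ⨅ m ∈ stableSet T, (m : ℕ∞)

/-- `T` is semi-regular: `R(T)` is closed and `dis(T) = 0`. -/
def IsSemiRegular (T : E →L[ℂ] E) : Prop :=
  IsClosed (Set.range T) ∧ dis T = 0

/-- `T` is nilpotent of degree `d`: `d` is the least natural number with `T ^ d = 0`.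
The operator on the zero space is nilpotent of degree `0`. -/
def IsNilpotentOfDegree (T : E →L[ℂ] E) (d : ℕ) : Prop :=
  IsLeast {k : ℕ | T ^ k = 0} d

/-- `(M, N) ∈ Red(T)`: `M` and `N` are closed `T`-invariant subspaces with `E = M ⊕ N`. -/
structure CompletelyReduces (T : E →L[ℂ] E) (M N : Submodule ℂ E) : Prop where
  isClosed_left : IsClosed (M : Set E)
  isClosed_right : IsClosed (N : Set E)
  invariant_left : ∀ x ∈ M, T x ∈ M
  invariant_right : ∀ x ∈ N, T x ∈ N
  isCompl : IsCompl M N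

/-- `T` is of Kato-type of degree `d`: there is `(M, N) ∈ Red(T)` such that the restriction of `T`
to `M` is semi-regular and the restriction of `T` to `N` is nilpotent of degree `d`. -/
def IsKatoType (T : E →L[ℂ] E) (d : ℕ) : Prop :=
  ∃ (M N : Submodule ℂ E) (h : CompletelyReduces T M N),
    IsSemiRegular (T.restrict h.invariant_left) ∧
      IsNilpotentOfDegree (T.restrict h.invariant_right) d

/-- The dual (Banach adjoint) operator `T* : X* → X*`, `f ↦ f ∘ T`. -/
noncomputable def dualOp (T : E →L[ℂ] E) : StrongDual ℂ E →L[ℂ] StrongDual ℂ E :=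
  ContinuousLinearMap.precomp ℂ T

end KatoType

/-! If `X = M ⊕ N` reduces `T`, then `X* = N^⊥ ⊕ M^⊥` reduces `T*`, and the two parts act as the
duals of `T|M` and `T|N`. Nilpotency and its degree pass to `M^⊥` by duality. On `N^⊥` the key is
`exists_dualOp_pow_eq`: the powers of `T|M` have closed range, so the closed range theorem lifts
functionals through them, with extension by zero on `N`. Semi-regularity of `T|M` then supplies the
needed vanishing on kernels. Finally `R(T*) + N((T*)^d)` equals `(M ∩ N(T))^⊥`, and annihilators are
weak-* closed. -/

namespace ContinuousLinearMap

variable {E F : Type*} [NormedAddCommGroup E] [NormedSpace ℂ E] [CompleteSpace E]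
  [NormedAddCommGroup F] [NormedSpace ℂ F] [CompleteSpace F]

/-- An operator with closed range between Banach spaces is a quotient map onto its range. -/
theorem isQuotientMap_rangeRestrict (S : E →L[ℂ] F) (hS : IsClosed (Set.range S)) :
    Topology.IsQuotientMap S.rangeRestrict := by
  have : CompleteSpace S.range := IsClosed.completeSpace_coe (hs := hS)
  exact S.rangeRestrict.isQuotientMap S.surjective_rangeRestrict

/-- One direction of the closed range theorem: if `S` has closed range, every functional vanishing
on the kernel of `S` lies in the range of the dual operator. -/
theorem exists_comp_eq_of_ker_le (S : E →L[ℂ] F) (hS : IsClosed (Set.range S))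
    (f : StrongDual ℂ E) (hf : ∀ x, S x = 0 → f x = 0) :
    ∃ g : StrongDual ℂ F, g.comp S = f := by
  have hle : LinearMap.ker (S : E →ₗ[ℂ] F) ≤ LinearMap.ker (f : E →ₗ[ℂ] ℂ) := fun x hx ↦ hf x hx
  let φ : S.range →ₗ[ℂ] ℂ := (LinearMap.ker (S : E →ₗ[ℂ] F)).liftQ (f : E →ₗ[ℂ] ℂ) hle ∘ₗ
    (S : E →ₗ[ℂ] F).quotKerEquivRange.symm.toLinearMap
  have hφ : ∀ x, φ (S.rangeRestrict x) = f x := by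
    intro x
    have h : (S : E →ₗ[ℂ] F).quotKerEquivRange.symm (S.rangeRestrict x) =
        (LinearMap.ker (S : E →ₗ[ℂ] F)).mkQ x := by
      rw [LinearEquiv.symm_apply_eq]
      rfl
    change (LinearMap.ker (S : E →ₗ[ℂ] F)).liftQ (f : E →ₗ[ℂ] ℂ) hle
      ((S : E →ₗ[ℂ] F).quotKerEquivRange.symm (S.rangeRestrict x)) = f x
    rw [h]
    rfl
  have hcont : Continuous φ := by
    -- Closed range enters here: continuity of `φ` may be tested after composing with the quotient
    -- map `S`.
    rw [(S.isQuotientMap_rangeRestrict hS).continuous_iff]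
    exact f.continuous.congr fun x ↦ (hφ x).symm
  obtain ⟨g, hg, -⟩ := exists_extension_norm_eq S.range ⟨φ, hcont⟩
  refine ⟨g, ContinuousLinearMap.ext fun x ↦ ?_⟩
  exact (hg (S.rangeRestrict x)).trans (hφ x)

/-- An operator with closed range maps closed subspaces containing its kernel to closed sets. -/
theorem isClosed_image_of_ker_le (S : E →L[ℂ] F) (hS : IsClosed (Set.range S))
    (W : Submodule ℂ E) (hW : IsClosed (W : Set E)) (hker : ∀ x, S x = 0 → x ∈ W) :
    IsClosed (S '' W) := by
  have himg : IsClosed (S.rangeRestrict '' W) := by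
    rw [← (S.isQuotientMap_rangeRestrict hS).isClosed_preimage]
    convert hW
    ext x
    constructor
    · rintro ⟨y, hy, hyx⟩
      have h0 : S (x - y) = 0 := by
        rw [map_sub, sub_eq_zero]
        exact (congrArg Subtype.val hyx).symm
      simpa using W.add_mem (hker _ h0) hy
    · exact fun hx ↦ ⟨x, hx, rfl⟩
  have hemb : Topology.IsClosedEmbedding (Subtype.val : S.range → F) :=
    Topology.IsClosedEmbedding.subtypeVal hS
  have := hemb.isClosedMap _ himg
  rwa [Set.image_image] at this

end ContinuousLinearMap

namespace KatoType

/-! ### Degree of stable iteration, restrictions and annihilators. -/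

section Algebraic

variable {E : Type*} [NormedAddCommGroup E] [NormedSpace ℂ E]

/-- An infimum of naturals in `ℕ∞` is `0` only if `0` belongs to the set, and `R(S ^ 0)` is the
whole space. -/
theorem dis_eq_zero_iff (S : E →L[ℂ] E) :
    dis S = 0 ↔ ∀ (r : ℕ) (x : E), S x = 0 → ∃ y, (S ^ r) y = x := by
  have hmem : dis S = 0 ↔ 0 ∈ stableSet S := by
    constructor
    · intro h
      by_contra h0
      have : (1 : ℕ∞) ≤ dis S := by
        refine le_iInf₂ fun m hm ↦ ?_
        have : m ≠ 0 := fun h ↦ h0 (h ▸ hm)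
        exact_mod_cast Nat.one_le_iff_ne_zero.2 this
      simp [h] at this
    · intro h
      exact nonpos_iff_eq_zero.1 (iInf₂_le 0 h)
  rw [hmem]
  constructor
  · intro h r x hx
    have hx0 : x ∈ kerRestrict S 0 := ⟨hx, x, rfl⟩
    rw [h r r.zero_le] at hx0
    exact hx0.2
  · intro h r _
    ext x
    exact ⟨fun hx ↦ ⟨hx.1, h r x hx.1⟩, fun hx ↦ ⟨hx.1, x, rfl⟩⟩

/-- If `N(S) ⊆ R(S ^ r)` for all `r`, then `N(S ^ k) ⊆ R(S)` for all `k`. -/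
theorem exists_apply_eq_of_pow_apply_eq_zero {S : E →L[ℂ] E} (hS : dis S = 0) (k : ℕ) :
    ∀ x, (S ^ k) x = 0 → ∃ y, S y = x := by
  rw [dis_eq_zero_iff] at hS
  induction k with
  | zero => exact fun x hx ↦ ⟨0, by simpa using hx.symm⟩
  | succ k ih =>
    intro x hx
    rw [pow_succ'] at hx
    -- Since `S ^ k x` lies in `N(S)`, it equals `S ^ (k + 1) y`, so `x - S y` lies in `N(S ^ k)`.
    obtain ⟨y, hy⟩ := hS (k + 1) _ hx
    obtain ⟨z, hz⟩ := ih (x - S y) (by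
      rw [map_sub, sub_eq_zero]
      exact hy.symm.trans (by rw [pow_succ]; rfl))
    exact ⟨z + y, by rw [map_add, hz, sub_add_cancel]⟩

theorem coe_restrict_pow_apply {T : E →L[ℂ] E} {M : Submodule ℂ E} (h : ∀ x ∈ M, T x ∈ M) (k : ℕ)
    (x : M) : (((T.restrict h) ^ k) x : E) = (T ^ k) x := by
  induction k generalizing x with
  | zero => rfl
  | succ k ih =>
    rw [pow_succ, pow_succ]
    exact ih _

theorem restrict_pow_eq_zero_iff {T : E →L[ℂ] E} {M : Submodule ℂ E} (h : ∀ x ∈ M, T x ∈ M)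
    (k : ℕ) : (T.restrict h) ^ k = 0 ↔ ∀ x ∈ M, (T ^ k) x = 0 := by
  constructor
  · intro hk x hx
    rw [← coe_restrict_pow_apply h k ⟨x, hx⟩, hk]
    rfl
  · intro hk
    ext x
    rw [coe_restrict_pow_apply]
    exact hk x x.2

set_option synthInstance.maxHeartbeats 200000 in
theorem dualOp_pow_apply (T : E →L[ℂ] E) (k : ℕ) (f : StrongDual ℂ E) (x : E) :
    (dualOp T ^ k) f x = f ((T ^ k) x) := by
  induction k generalizing f with
  | zero => rfl
  | succ k ih =>
    rw [pow_succ, pow_succ']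
    exact ih _

/-- The annihilator of a subspace in the strong dual. -/
def annihilator (M : Submodule ℂ E) : Submodule ℂ (StrongDual ℂ E) where
  carrier := {f | ∀ x ∈ M, f x = 0}
  add_mem' hf hg x hx := by simp [hf x hx, hg x hx]
  zero_mem' x _ := rfl
  smul_mem' c f hf x hx := by simp [hf x hx]

theorem mem_annihilator {M : Submodule ℂ E} {f : StrongDual ℂ E} :
    f ∈ annihilator M ↔ ∀ x ∈ M, f x = 0 := Iff.rfl

theorem isClosed_annihilator (M : Submodule ℂ E) :
    IsClosed (annihilator M : Set (StrongDual ℂ E)) := by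
  have : (annihilator M : Set (StrongDual ℂ E)) = ⋂ x ∈ M, {f | f x = 0} := by
    ext f
    simp [mem_annihilator]
  rw [this]
  exact isClosed_biInter fun x _ ↦
    isClosed_eq (ContinuousLinearMap.apply ℂ ℂ x).continuous continuous_const

theorem isClosed_toWeakDual_image_annihilator (M : Submodule ℂ E) :
    IsClosed (StrongDual.toWeakDual '' (annihilator M : Set (StrongDual ℂ E))) := by
  have : StrongDual.toWeakDual '' (annihilator M : Set (StrongDual ℂ E)) =
      ⋂ x ∈ M, {f : WeakDual ℂ E | f x = 0} := by
    ext f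
    simp only [Set.mem_iInter, Set.mem_ofPred_eq]
    constructor
    · rintro ⟨g, hg, rfl⟩ x hx
      exact hg x hx
    · exact fun hf ↦ ⟨WeakDual.toStrongDual f, hf, rfl⟩
  rw [this]
  exact isClosed_biInter fun x _ ↦ isClosed_eq (WeakDual.eval_continuous x) continuous_const

theorem dualOp_mem_annihilator {T : E →L[ℂ] E} {M : Submodule ℂ E} (h : ∀ x ∈ M, T x ∈ M) :
    ∀ f ∈ annihilator M, dualOp T f ∈ annihilator M :=
  fun _ hf x hx ↦ hf _ (h x hx)

end Algebraic

section Banach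

variable {E : Type*} [NormedAddCommGroup E] [NormedSpace ℂ E] [CompleteSpace E]

/-- All powers of a semi-regular operator have closed range. -/
theorem IsSemiRegular.isClosed_range_pow {S : E →L[ℂ] E} (hS : IsSemiRegular S) (n : ℕ) :
    IsClosed (Set.range (S ^ n : E →L[ℂ] E)) := by
  induction n with
  | zero =>
    have : Set.range (S ^ 0 : E →L[ℂ] E) = Set.univ := Set.range_eq_univ.2 fun x ↦ ⟨x, rfl⟩
    rw [this]
    exact isClosed_univ
  | succ n ih =>
    -- `R(S ^ (n + 1))` is the image under `S` of `R(S ^ n)`, which contains `N(S)`.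
    have := S.isClosed_image_of_ker_le hS.1 (S ^ n : E →L[ℂ] E).range ih
      fun x hx ↦ (dis_eq_zero_iff S).1 hS.2 n x hx
    convert this
    ext x
    constructor
    · rintro ⟨y, rfl⟩
      exact ⟨(S ^ n) y, ⟨y, rfl⟩, by rw [pow_succ']; rfl⟩
    · rintro ⟨_, ⟨y, rfl⟩, rfl⟩
      exact ⟨y, by rw [pow_succ']; rfl⟩

/-- The continuous projections attached to a pair of closed complementary subspaces. -/
theorem CompletelyReduces.exists_projections {T : E →L[ℂ] E} {M N : Submodule ℂ E}
    (h : CompletelyReduces T M N) :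
    ∃ (P : E →L[ℂ] M) (Q : E →L[ℂ] N), (∀ x, (P x : E) + Q x = x) ∧
      (∀ x : M, P x = x) ∧ (∀ x : N, P x = 0) ∧ (∀ x : M, Q x = 0) ∧ (∀ x : N, Q x = x) := by
  have hMN : Submodule.IsTopCompl M N :=
    Submodule.isTopCompl_iff_isCompl_isClosed.2 ⟨h.isCompl, h.isClosed_left, h.isClosed_right⟩
  exact ⟨M.projectionOntoL N hMN, N.projectionOntoL M hMN.symm,
    Submodule.projectionL_add_projectionL_eq_self hMN, Submodule.projectionOntoL_apply_left hMN,
    Submodule.projectionOntoL_apply_right hMN, Submodule.projectionOntoL_apply_right hMN.symm,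
    Submodule.projectionOntoL_apply_left hMN.symm⟩

end Banach

/-! ### The reduction of the dual operator. -/

section Dual

variable {X : Type*} [NormedAddCommGroup X] [NormedSpace ℂ X] [CompleteSpace X]
  {T : X →L[ℂ] X} {M N : Submodule ℂ X}

/-- Annihilators of a reducing pair reduce the dual operator. -/
theorem CompletelyReduces.dualOp (h : CompletelyReduces T M N) :
    CompletelyReduces (dualOp T) (annihilator N) (annihilator M) where
  isClosed_left := isClosed_annihilator N
  isClosed_right := isClosed_annihilator M
  invariant_left := dualOp_mem_annihilator h.invariant_right
  invariant_right := dualOp_mem_annihilator h.invariant_left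
  isCompl := by
    obtain ⟨P, Q, hPQ, hPM, hPN, hQM, hQN⟩ := h.exists_projections
    constructor
    · rw [Submodule.disjoint_def]
      intro f hN hM
      ext x
      rw [← hPQ x, map_add, hM _ (P x).2, hN _ (Q x).2]
      simp
    · rw [codisjoint_iff, eq_top_iff]
      intro f _
      refine Submodule.mem_sup.2 ⟨f.comp (M.subtypeL.comp P), ?_, f.comp (N.subtypeL.comp Q), ?_, ?_⟩
      · intro x hx
        simpa using congrArg (fun y : M ↦ f y) (hPN ⟨x, hx⟩)
      · intro x hx
        simpa using congrArg (fun y : N ↦ f y) (hQM ⟨x, hx⟩)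
      · ext x
        change f (P x) + f (Q x) = f x
        rw [← map_add, hPQ]

/-- A functional vanishing on `N` and on `M ∩ N(T ^ r)` is the image under `T* ^ r` of a functional
vanishing on `N`. -/
theorem CompletelyReduces.exists_dualOp_pow_eq (h : CompletelyReduces T M N)
    (hS : IsSemiRegular (T.restrict h.invariant_left)) (r : ℕ) (f : StrongDual ℂ X)
    (hfN : f ∈ annihilator N) (hf : ∀ x ∈ M, (T ^ r) x = 0 → f x = 0) :
    ∃ g ∈ annihilator N, (KatoType.dualOp T ^ r) g = f := by
  have : CompleteSpace M := IsClosed.completeSpace_coe (hs := h.isClosed_left)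
  obtain ⟨P, Q, hPQ, hPM, hPN, hQM, hQN⟩ := h.exists_projections
  obtain ⟨g, hg⟩ := ContinuousLinearMap.exists_comp_eq_of_ker_le ((T.restrict h.invariant_left) ^ r)
    (hS.isClosed_range_pow r) (f.comp M.subtypeL) fun x hx ↦ hf x x.2 (by
      rw [← coe_restrict_pow_apply h.invariant_left, hx]; rfl)
  have hTN : ∀ x ∈ N, (T ^ r) x ∈ N := fun x hx ↦ by
    rw [← coe_restrict_pow_apply h.invariant_right r ⟨x, hx⟩]
    exact Subtype.property _
  have hgN : g.comp P ∈ annihilator N := fun x hx ↦ by simp [hPN ⟨x, hx⟩]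
  refine ⟨g.comp P, hgN, ?_⟩
  ext x
  rw [dualOp_pow_apply, ← hPQ x, map_add, map_add, map_add, hgN _ (hTN _ (Q x).2),
    hfN _ (Q x).2, add_zero, add_zero, ← coe_restrict_pow_apply h.invariant_left]
  have := DFunLike.congr_fun hg (P x)
  simpa [hPM] using this

set_option synthInstance.maxHeartbeats 200000 in
theorem CompletelyReduces.isSemiRegular_dualOp (h : CompletelyReduces T M N)
    (hS : IsSemiRegular (T.restrict h.invariant_left)) :
    IsSemiRegular (E := annihilator N) ((KatoType.dualOp T).restrict h.dualOp.invariant_left) := by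
  constructor
  · have : Set.range ((KatoType.dualOp T).restrict h.dualOp.invariant_left) =
        Subtype.val ⁻¹' (annihilator (M ⊓ LinearMap.ker (T : X →ₗ[ℂ] X)) :
          Set (StrongDual ℂ X)) := by
      ext f
      constructor
      · rintro ⟨g, rfl⟩ x ⟨-, hx⟩
        change g.1 (T x) = 0
        rw [show T x = 0 from hx, map_zero]
      · intro hf
        obtain ⟨g, hgN, hg⟩ := h.exists_dualOp_pow_eq hS 1 f f.2 fun x hxM hx ↦
          hf x ⟨hxM, by simpa using hx⟩
        exact ⟨⟨g, hgN⟩, Subtype.ext (by simpa using hg)⟩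
    rw [this]
    exact (isClosed_annihilator _).preimage continuous_subtype_val
  · rw [dis_eq_zero_iff]
    intro r f hf
    -- A functional in `N(T*)` kills `R(T)`, which contains `M ∩ N(T ^ r)`.
    obtain ⟨g, hgN, hg⟩ := h.exists_dualOp_pow_eq hS r f f.2 fun x hxM hx ↦ by
      obtain ⟨y, hy⟩ := exists_apply_eq_of_pow_apply_eq_zero hS.2 r ⟨x, hxM⟩
        (Subtype.ext (by rw [coe_restrict_pow_apply]; exact hx))
      have hy' : T y = x := congrArg Subtype.val hy
      rw [← hy']
      exact DFunLike.congr_fun (congrArg Subtype.val hf) (y : X)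
    exact ⟨⟨g, hgN⟩, Subtype.ext (by rw [coe_restrict_pow_apply]; exact hg)⟩

set_option synthInstance.maxHeartbeats 200000 in
theorem CompletelyReduces.restrict_dualOp_pow_eq_zero_iff (h : CompletelyReduces T M N) (k : ℕ) :
    ((KatoType.dualOp T).restrict h.dualOp.invariant_right) ^ k = 0 ↔
      (T.restrict h.invariant_right) ^ k = 0 := by
  obtain ⟨P, Q, hPQ, hPM, hPN, hQM, hQN⟩ := h.exists_projections
  rw [restrict_pow_eq_zero_iff, restrict_pow_eq_zero_iff]
  constructor
  · intro hk x hx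
    refine SeparatingDual.eq_zero_of_forall_dual_eq_zero (R := ℂ) fun g ↦ ?_
    -- Composing with the projection onto `N` moves `g` into `M^⊥` without changing it on `N`.
    have hmem : g.comp (N.subtypeL.comp Q) ∈ annihilator M := fun y hy ↦ by simp [hQM ⟨y, hy⟩]
    have := DFunLike.congr_fun (hk _ hmem) x
    rw [dualOp_pow_apply, ← coe_restrict_pow_apply h.invariant_right k ⟨x, hx⟩] at this
    rw [← coe_restrict_pow_apply h.invariant_right k ⟨x, hx⟩]
    simpa [hQN] using this
  · intro hk f hf
    ext x
    rw [dualOp_pow_apply, ← hPQ x, map_add, hk _ (Q x).2, add_zero,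
      ← coe_restrict_pow_apply h.invariant_left, hf _ (Subtype.property _)]
    rfl

set_option synthInstance.maxHeartbeats 200000 in
theorem CompletelyReduces.range_sup_ker_dualOp (h : CompletelyReduces T M N)
    (hS : IsSemiRegular (T.restrict h.invariant_left)) {d : ℕ}
    (hd : (T.restrict h.invariant_right) ^ d = 0) :
    LinearMap.range (KatoType.dualOp T : StrongDual ℂ X →ₗ[ℂ] StrongDual ℂ X) ⊔
      LinearMap.ker ((KatoType.dualOp T ^ d : StrongDual ℂ X →L[ℂ] StrongDual ℂ X) :
        StrongDual ℂ X →ₗ[ℂ] StrongDual ℂ X) =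
      annihilator (M ⊓ LinearMap.ker (T : X →ₗ[ℂ] X)) := by
  apply le_antisymm
  · refine sup_le ?_ ?_
    · rintro _ ⟨g, rfl⟩ x ⟨-, hx⟩
      change g (T x) = 0
      rw [show T x = 0 from hx, map_zero]
    · rintro f hf x ⟨hxM, hx⟩
      -- Writing `x = T ^ d y` turns `f x` into `((T*) ^ d f) y = 0`.
      obtain ⟨y, hy⟩ := (dis_eq_zero_iff _).1 hS.2 d ⟨x, hxM⟩ (Subtype.ext hx)
      have hy' : (T ^ d) y = x := by rw [← coe_restrict_pow_apply h.invariant_left, hy]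
      rw [← hy', ← dualOp_pow_apply]
      exact DFunLike.congr_fun (show (KatoType.dualOp T ^ d) f = 0 from hf) (y : X)
  · intro f hf
    obtain ⟨f₁, hf₁, f₂, hf₂, rfl⟩ := Submodule.mem_sup.1
      (h.dualOp.isCompl.sup_eq_top ▸ Submodule.mem_top : f ∈ annihilator N ⊔ annihilator M)
    -- As `f₂` vanishes on `M`, `f₁` inherits vanishing on `M ∩ N(T)`; so `f₁` is in `R(T*)`, while
    -- `(T*) ^ d` kills `f₂`.
    obtain ⟨g, -, hg⟩ := h.exists_dualOp_pow_eq hS 1 f₁ hf₁ fun x hxM hx ↦ by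
      simpa [hf₂ x hxM] using hf x ⟨hxM, by simpa using hx⟩
    refine Submodule.add_mem_sup ⟨g, by simpa using hg⟩ ?_
    have := (h.restrict_dualOp_pow_eq_zero_iff d).2 hd
    exact (restrict_pow_eq_zero_iff _ _).1 this f₂ hf₂

end Dual

end KatoType

set_option synthInstance.maxHeartbeats 200000 in
theorem mainTheorem6 {X : Type*} [NormedAddCommGroup X] [NormedSpace ℂ X] [CompleteSpace X]
    (T : X →L[ℂ] X) (d : ℕ) (hT : KatoType.IsKatoType T d) :
    KatoType.IsKatoType (KatoType.dualOp T) d ∧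
      IsClosed (StrongDual.toWeakDual ''
        ((LinearMap.range (KatoType.dualOp T : StrongDual ℂ X →ₗ[ℂ] StrongDual ℂ X) ⊔
          LinearMap.ker ((KatoType.dualOp T ^ d : StrongDual ℂ X →L[ℂ] StrongDual ℂ X) :
            StrongDual ℂ X →ₗ[ℂ] StrongDual ℂ X) :
          Submodule ℂ (StrongDual ℂ X)) : Set (StrongDual ℂ X)) : Set (WeakDual ℂ X)) := by
  obtain ⟨M, N, h, hS, hd⟩ := hT
  refine ⟨⟨_, _, h.dualOp, h.isSemiRegular_dualOp hS, ?_⟩, ?_⟩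
  · have : {k : ℕ | ((KatoType.dualOp T).restrict h.dualOp.invariant_right) ^ k = 0} =
        {k : ℕ | (T.restrict h.invariant_right) ^ k = 0} :=
      Set.ext fun k ↦ h.restrict_dualOp_pow_eq_zero_iff k
    rw [KatoType.IsNilpotentOfDegree, this]
    exact hd
  · rw [h.range_sup_ker_dualOp hS hd.1]
    exact KatoType.isClosed_toWeakDual_image_annihilator _
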